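/- Let $\Omega\subset\mathbb R^N$ be a bounded open set, $s\in(0,1)$ with $N>2s$, and $p\in\left(1,\frac{N+2s}{N-2s}\right)$. Let $H^s_0(\Omega)$ be the space of all $v\in L^2(\mathbb R^N)$ with $v=0$ a.e. outside $\Omega$ and $\langle v,v\rangle<\infty$, where $$\langle v,w\rangle=\int_{\mathbb R^N}\int_{\mathbb R^N}\frac{(v(x)-v(y))(w(x)-w(y))}{|x-y|^{N+2s}}\,dx\,dy .$$ Equations for $(-\Delta)^s$ in $\Omega$, with zero condition outside $\Omega$, are understood weakly in $H^s_0(\Omega)$, $\langle\cdot,\cdot\rangle$ being the weak form of $(-\Delta)^s$ (the normalizing constant of the fractional laplacian is omitted). Let $\lambda_1(\Omega)$ be the smallest $\ell\in\mathbb R$ for which $(-\Delta)^s v=\ell v$ has a nontrivial solution $v\in H^s_0(\Omega)$, and let $\lambda<\lambda_1(\Omega)$. Let $u$ be a least-energy solution of $$(-\Delta)^s u=\lambda u+|u|^{p-1}u\ \text{ in }\Omega,\qquad u=0\ \text{ in }\mathbb R^N\setminus\Omega,$$ that is, a weak solution $u\in H^s_0(\Omega)$ which is a positive multiple of a minimizer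 of $\Phi(v)=\langle v,v\rangle-\lambda\int_\Omega v^2$ over all $v\in H^s_0(\Omega)$ with $\int_\Omega|v|^{p+1}=1$. Consider the linearized eigenvalue problem $$(-\Delta)^s v-p|u|^{p-1}v-\lambda v=\mu v\ \text{ in }\Omega,\qquad v=0\ \text{ in }\mathbb R^N\setminus\Omega,$$ that is, $v\in H^s_0(\Omega)\setminus\{0\}$ and $\langle v,\varphi\rangle-\int_\Omega(p|u|^{p-1}+\lambda)v\varphi=\mu\int_\Omega v\varphi$ for all $\varphi\in H^s_0(\Omega)$, and let $\mu_1\le\mu_2\le\cdots$ be its eigenvalues, repeated according to multiplicity. Then $$\mu_2\ge 0 .$$ Moreover, the Morse index of $u$, i.e. the number of negative eigenvalues of the linearized problem counted with multiplicity, is at most one. -/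

import Mathlib

open MeasureTheory

namespace FracLaplace

/-- The Hilbert space `L²(ℝᴺ)` of real functions modulo equality almost everywhere. -/
abbrev L2 (N : ℕ) : Type := Lp ℝ 2 (volume : Measure (EuclideanSpace ℝ (Fin N)))

/-- Finiteness of the Gagliardo seminorm: `(u(x) - u(y))² / |x - y|^(N + 2s)` is integrable
on `ℝᴺ × ℝᴺ`. -/
def FiniteGagliardo {N : ℕ} (s : ℝ) (u : L2 N) : Prop :=
  Integrable (fun z : EuclideanSpace ℝ (Fin N) × EuclideanSpace ℝ (Fin N) =>
    (u z.1 - u z.2) ^ 2 / ‖z.1 - z.2‖ ^ ((N : ℝ) + 2 * s)) volume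

lemma ae_prod_of_ae {N : ℕ} {P : EuclideanSpace ℝ (Fin N) → Prop} (h : ∀ᵐ x, P x) :
    ∀ᵐ z : EuclideanSpace ℝ (Fin N) × EuclideanSpace ℝ (Fin N), P z.1 ∧ P z.2 := by
  have h1 := (Measure.quasiMeasurePreserving_fst (μ := (volume : Measure
    (EuclideanSpace ℝ (Fin N)))) (ν := (volume : Measure (EuclideanSpace ℝ (Fin N))))).ae h
  have h2 := (Measure.quasiMeasurePreserving_snd (μ := (volume : Measure
    (EuclideanSpace ℝ (Fin N)))) (ν := (volume : Measure (EuclideanSpace ℝ (Fin N))))).ae h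
  exact h1.and h2

lemma aestronglyMeasurable_gagliardo {N : ℕ} (s : ℝ) (u : L2 N) :
    AEStronglyMeasurable
      (fun z : EuclideanSpace ℝ (Fin N) × EuclideanSpace ℝ (Fin N) =>
        (u z.1 - u z.2) ^ 2 / ‖z.1 - z.2‖ ^ ((N : ℝ) + 2 * s)) volume := by
  have hu := (Lp.stronglyMeasurable u).measurable
  have : Measurable (fun z : EuclideanSpace ℝ (Fin N) × EuclideanSpace ℝ (Fin N) =>
        (u z.1 - u z.2) ^ 2 / ‖z.1 - z.2‖ ^ ((N : ℝ) + 2 * s)) := by fun_prop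
  exact this.aestronglyMeasurable

/-- The space `H^s_0(Ω)`: the `u ∈ L²(ℝᴺ)` that vanish almost everywhere outside `Ω` and have
finite Gagliardo seminorm. -/
def Hs0 {N : ℕ} (Ω : Set (EuclideanSpace ℝ (Fin N))) (s : ℝ) : Submodule ℝ (L2 N) where
  carrier := {u | (∀ᵐ x, x ∉ Ω → u x = 0) ∧ FiniteGagliardo s u}
  zero_mem' := by
    have h0 := Lp.coeFn_zero ℝ 2 (volume : Measure (EuclideanSpace ℝ (Fin N)))
    refine ⟨?_, ?_⟩
    · filter_upwards [h0] with x hx _ using hx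
    · refine (integrable_zero _ _ _).congr ?_
      filter_upwards [ae_prod_of_ae h0] with z hz
      rw [hz.1, hz.2]
      simp
  add_mem' := by
    intro u v hu hv
    have h0 := Lp.coeFn_add u v
    refine ⟨?_, ?_⟩
    · filter_upwards [h0, hu.1, hv.1] with x hx h1 h2 h3
      rw [hx, Pi.add_apply, h1 h3, h2 h3, add_zero]
    · refine ((hu.2.const_mul 2).add (hv.2.const_mul 2)).mono'
        (aestronglyMeasurable_gagliardo s (u + v)) ?_
      filter_upwards [ae_prod_of_ae h0] with z hz
      have hn : 0 ≤ ‖z.1 - z.2‖ ^ ((N : ℝ) + 2 * s) := by positivity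
      rw [Real.norm_of_nonneg (by positivity)]
      simp only [hz.1, hz.2, Pi.add_apply]
      rw [← mul_div_assoc, ← mul_div_assoc, ← add_div]
      apply div_le_div_of_nonneg_right _ hn
      nlinarith [sq_nonneg ((u z.1 - u z.2) - (v z.1 - v z.2))]
  smul_mem' := by
    intro c u hu
    have h0 := Lp.coeFn_smul c u
    refine ⟨?_, ?_⟩
    · filter_upwards [h0, hu.1] with x hx h1 h3
      simp [hx, h1 h3]
    · refine (hu.2.const_mul (c ^ 2)).congr ?_
      filter_upwards [ae_prod_of_ae h0] with z hz
      simp only [hz.1, hz.2, Pi.smul_apply, smul_eq_mul]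
      ring

/-- The scalar product `⟨u, v⟩` of `H^s_0(Ω)`; it is the weak form of the fractional laplacian.
In particular `⟨u, u⟩` is the square of the Gagliardo seminorm of `u`. -/
noncomputable def gagliardoInner {N : ℕ} (s : ℝ) (u v : L2 N) : ℝ :=
  ∫ z : EuclideanSpace ℝ (Fin N) × EuclideanSpace ℝ (Fin N),
    (u z.1 - u z.2) * (v z.1 - v z.2) / ‖z.1 - z.2‖ ^ ((N : ℝ) + 2 * s)

/-- `v` is an eigenfunction with eigenvalue `m` of the problem `(-Δ)^s v - V v = m v` in `Ω`,
`v = 0` outside `Ω`, in the weak sense. -/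
def IsEigenfunction {N : ℕ} (Ω : Set (EuclideanSpace ℝ (Fin N))) (s : ℝ)
    (V : EuclideanSpace ℝ (Fin N) → ℝ) (m : ℝ) (v : L2 N) : Prop :=
  v ∈ Hs0 Ω s ∧ v ≠ 0 ∧
    ∀ φ ∈ Hs0 Ω s,
      gagliardoInner s v φ - ∫ x in Ω, V x * v x * φ x = m * ∫ x in Ω, v x * φ x

/-- `l` is the first eigenvalue `λ₁(Ω)` of the fractional laplacian in `Ω`: the smallest real
number for which `(-Δ)^s v = l v` has a nontrivial solution in `H^s_0(Ω)`. -/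
def IsFirstEigenvalue {N : ℕ} (Ω : Set (EuclideanSpace ℝ (Fin N))) (s l : ℝ) : Prop :=
  IsLeast {m : ℝ | ∃ v, IsEigenfunction Ω s (fun _ => 0) m v} l

/-- The functional `Φ(v) = [v]² - lam ∫_Ω v²`. -/
noncomputable def energy {N : ℕ} (Ω : Set (EuclideanSpace ℝ (Fin N))) (s lam : ℝ) (v : L2 N) : ℝ :=
  gagliardoInner s v v - lam * ∫ x in Ω, v x ^ 2

/-- `w` minimizes `Φ` on `H^s_0(Ω)` under the constraint `∫_Ω |w|^(p+1) = 1`. -/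
def IsConstrainedMinimizer {N : ℕ} (Ω : Set (EuclideanSpace ℝ (Fin N))) (s lam p : ℝ)
    (w : L2 N) : Prop :=
  w ∈ Hs0 Ω s ∧ ∫ x in Ω, |w x| ^ (p + 1) = 1 ∧
    ∀ v ∈ Hs0 Ω s, ∫ x in Ω, |v x| ^ (p + 1) = 1 → energy Ω s lam w ≤ energy Ω s lam v

/-- `u` is a weak solution of `(-Δ)^s u = lam u + u^p` in `Ω`, `u = 0` outside `Ω`, where `u^p`
stands for the odd power `|u|^(p-1) u`. -/
def IsWeakSolution {N : ℕ} (Ω : Set (EuclideanSpace ℝ (Fin N))) (s lam p : ℝ)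
    (u : L2 N) : Prop :=
  u ∈ Hs0 Ω s ∧
    ∀ φ ∈ Hs0 Ω s,
      gagliardoInner s u φ = ∫ x in Ω, (lam * u x + |u x| ^ (p - 1) * u x) * φ x

/-- A least energy solution: a solution obtained, up to the scaling that normalizes the Lagrange
multiplier, by minimization of `Φ` under the constraint `∫_Ω |w|^(p+1) = 1`. -/
def IsLeastEnergySolution {N : ℕ} (Ω : Set (EuclideanSpace ℝ (Fin N))) (s lam p : ℝ)
    (u : L2 N) : Prop :=
  IsWeakSolution Ω s lam p u ∧
    ∃ (c : ℝ) (w : L2 N), 0 < c ∧ IsConstrainedMinimizer Ω s lam p w ∧ u = c • w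

/-- `v` is an eigenfunction, with eigenvalue `m`, of the problem linearized at `u`,
`(-Δ)^s v - p |u|^(p-1) v - lam v = m v` in `Ω`, `v = 0` outside `Ω`. -/
def IsLinearizedEigenfunction {N : ℕ} (Ω : Set (EuclideanSpace ℝ (Fin N))) (s lam p : ℝ)
    (u : L2 N) (m : ℝ) (v : L2 N) : Prop :=
  IsEigenfunction Ω s (fun x => p * |u x| ^ (p - 1) + lam) m v

/-- The number of eigenvalues of the linearized problem that lie in `S`, counted with
multiplicity: eigenfunctions of different eigenvalues are linearly independent, so the sum of the
dimensions of the eigenspaces is the dimension of the span of their eigenfunctions. -/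
noncomputable def eigenvalueCount {N : ℕ} (Ω : Set (EuclideanSpace ℝ (Fin N))) (s lam p : ℝ)
    (u : L2 N) (S : Set ℝ) : Cardinal :=
  Module.rank ℝ (Submodule.span ℝ {v : L2 N | ∃ m ∈ S, IsLinearizedEigenfunction Ω s lam p u m v})

/-- `m` is the `k`-th entry (`k ≥ 1`) of the nondecreasing list of the eigenvalues of the
linearized problem, each repeated according to its multiplicity: the least number such that at
least `k` eigenvalues, counted with multiplicity, do not exceed it. -/
def IsNthLinearizedEigenvalue {N : ℕ} (Ω : Set (EuclideanSpace ℝ (Fin N))) (s lam p : ℝ)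
    (u : L2 N) (k : ℕ) (m : ℝ) : Prop :=
  IsLeast {t : ℝ | (k : Cardinal) ≤ eigenvalueCount Ω s lam p u (Set.Iic t)} m

/-- The Morse index of `u`: the number of negative eigenvalues of the linearized problem, counted
with multiplicity. -/
noncomputable def morseIndex {N : ℕ} (Ω : Set (EuclideanSpace ℝ (Fin N))) (s lam p : ℝ)
    (u : L2 N) : Cardinal :=
  eigenvalueCount Ω s lam p u (Set.Iio 0)

end FracLaplace

/-! Write `u = c • w` with `w` a constrained minimizer and E = Φ(w). Testing the equation with `u`
gives E = c^(p-1) > 0, and homogeneity turns minimality into E (∫_Ω |v|^(p+1))^(2/(p+1)) ≤ Φ(v),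
whenever the integral is positive.

The heart is `IsConstrainedMinimizer.second_variation`. Let `v` be tangent to the constraint, ∫_Ω
|w|^(p-1) w v = 0. The equation then removes the cross term of Φ, so Φ(w + tv) = E + t² Φ(v)
exactly, and minimality bounds ∫_Ω |w + tv|^(p+1) by (1 + t² Φ(v)/E)^((p+1)/2). Subtract 1, divide
by t² and let t → 0. By convexity the integrands on the left are nonnegative after removal of the
linear term, which has integral zero, so Fatou's lemma yields p E ∫_Ω |w|^(p-1) v² ≤ Φ(v). Since E
|w|^(p-1) = |u|^(p-1), the quadratic form of the linearized problem is nonnegative on a subspace of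
codimension at most one. Two independent eigenfunctions with negative eigenvalues would span a plane
on which the form is negative definite, and every plane meets that subspace nontrivially
(`IsLeastEnergySolution.mem_span_singleton`).

Integrability needs care, as the integral of a nonintegrable function is 0 by convention. That
H^s_0(Ω) lies in L^(p+1)(Ω) follows from the minimality inequality itself, applied to truncations
(`IsConstrainedMinimizer.integrableOn_abs_rpow`). -/

namespace FracLaplace

open Filter Topology

variable {N : ℕ}

/-! ### Elementary inequalities and limits for powers of the absolute value -/

lemma abs_rpow_sub_one_mul_sq {p : ℝ} (hp : 1 < p) (a : ℝ) :
    |a| ^ (p - 1) * a ^ 2 = |a| ^ (p + 1) := by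
  rcases eq_or_ne a 0 with rfl | ha
  · simp [Real.zero_rpow (by linarith : p + 1 ≠ 0)]
  · have h := abs_pos.mpr ha
    rw [← sq_abs a, ← Real.rpow_natCast, ← Real.rpow_add h]
    congr 1
    push_cast
    ring

/-- Convexity of |·|^(p+1): the graph lies above its tangent at `a`. By homogeneity this reduces to
Bernoulli's inequality. -/
lemma abs_rpow_add_ge_tangent {p : ℝ} (hp : 1 < p) (a b : ℝ) :
    |a| ^ (p + 1) + (p + 1) * (|a| ^ (p - 1) * a * b) ≤ |a + b| ^ (p + 1) := by
  rcases eq_or_ne a 0 with rfl | ha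
  · simp [Real.zero_rpow (by linarith : p + 1 ≠ 0)]
    positivity
  · obtain ⟨x, rfl⟩ : ∃ x, b = a * x := ⟨b / a, by field_simp⟩
    have h1 : |a| ^ (p - 1) * a * (a * x) = |a| ^ (p + 1) * x := by
      rw [← abs_rpow_sub_one_mul_sq hp a]; ring
    have h2 : |a + a * x| ^ (p + 1) = |a| ^ (p + 1) * |1 + x| ^ (p + 1) := by
      rw [← Real.mul_rpow (abs_nonneg _) (abs_nonneg _), ← abs_mul]; congr 2; ring
    have h3 : 1 + (p + 1) * x ≤ |1 + x| ^ (p + 1) := by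
      rcases le_total (-1) x with hx | hx
      · rw [abs_of_nonneg (by linarith)]
        exact one_add_mul_self_le_rpow_one_add hx (by linarith)
      -- Outside the range of Bernoulli's inequality the left side is at most -p, hence negative.
      · have : 0 ≤ |1 + x| ^ (p + 1) := by positivity
        nlinarith
    rw [h1, h2]
    have h4 : 0 ≤ |a| ^ (p + 1) := by positivity
    nlinarith [mul_le_mul_of_nonneg_left h3 h4]

/-- One use of l'Hôpital's rule leaves r/2 times the difference quotient of (1 + x)^(r-1) at 0. -/
lemma tendsto_rpow_second_quotient (r : ℝ) :
    Tendsto (fun x : ℝ => (|1 + x| ^ r - 1 - r * x) / x ^ 2) (𝓝[≠] 0) (𝓝 (r * (r - 1) / 2)) := by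
  have hpos : ∀ᶠ x : ℝ in 𝓝[≠] 0, 0 < 1 + x :=
    nhdsWithin_le_nhds ((continuous_const.add continuous_id).continuousAt.eventually
      (lt_mem_nhds (by simp)))
  have hlin (x : ℝ) : HasDerivAt (fun x : ℝ => 1 + x) 1 x := (hasDerivAt_id x).const_add 1
  have key : Tendsto (fun x : ℝ => ((1 + x) ^ r - 1 - r * x) / x ^ 2) (𝓝[≠] 0)
      (𝓝 (r * (r - 1) / 2)) := by
    refine HasDerivAt.lhopital_zero_nhdsNE (f' := fun x => r * (1 + x) ^ (r - 1) - r)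
      (g' := fun x => 2 * x) ?_ ?_ ?_ ?_ ?_ ?_
    · filter_upwards [hpos] with x hx
      have h := ((hlin x).rpow_const (p := r) (Or.inl hx.ne')).sub_const 1
      exact (h.sub ((hasDerivAt_id x).const_mul r)).congr_deriv (by ring)
    · exact Eventually.of_forall fun x => by simpa using hasDerivAt_pow 2 x
    · filter_upwards [self_mem_nhdsWithin] with x hx
      simpa using hx
    · have : ContinuousAt (fun x : ℝ => (1 + x) ^ r - 1 - r * x) 0 := by
        refine ContinuousAt.sub (ContinuousAt.sub ?_ continuousAt_const) (by fun_prop)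
        exact (hlin 0).continuousAt.rpow_const (Or.inl (by simp))
      have h := this.tendsto.mono_left (nhdsWithin_le_nhds (s := {0}ᶜ))
      simpa using h
    · have : ContinuousAt (fun x : ℝ => x ^ 2) 0 := by fun_prop
      have h := this.tendsto.mono_left (nhdsWithin_le_nhds (s := {0}ᶜ))
      simpa using h
    · have hd : HasDerivAt (fun x : ℝ => (1 + x) ^ (r - 1)) (r - 1) 0 := by
        simpa using (hlin 0).rpow_const (p := r - 1) (Or.inl (by simp))
      have h := (hd.tendsto_slope).const_mul (r / 2)
      have h' : r / 2 * (r - 1) = r * (r - 1) / 2 := by ring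
      rw [h'] at h
      refine h.congr' ?_
      filter_upwards [self_mem_nhdsWithin] with x hx
      have hx : x ≠ 0 := hx
      simp only [slope_def_field, add_zero, Real.one_rpow, sub_zero]
      field_simp
  refine key.congr' ?_
  filter_upwards [hpos] with x hx
  rw [abs_of_pos hx]

/-- For `a ≠ 0`, scaling by `a` reduces to the expansion at 1. For `a = 0` the quotient is |t|^(p-1)
|b|^(p+1), which tends to 0 because p > 1. -/
lemma tendsto_abs_rpow_second_quotient {p : ℝ} (hp : 1 < p) (a b : ℝ) :
    Tendsto (fun t : ℝ => (|a + t * b| ^ (p + 1) - |a| ^ (p + 1)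
      - (p + 1) * (|a| ^ (p - 1) * a * (t * b))) / t ^ 2) (𝓝[≠] 0)
      (𝓝 ((p + 1) * p / 2 * (|a| ^ (p - 1) * b ^ 2))) := by
  rcases eq_or_ne b 0 with rfl | hb
  · simp
  rcases eq_or_ne a 0 with rfl | ha
  · have hc : ContinuousAt (fun t : ℝ => |t| ^ (p - 1) * |b| ^ (p + 1)) 0 :=
      (continuous_abs.continuousAt.rpow_const (Or.inr (by linarith))).mul continuousAt_const
    have h := hc.tendsto.mono_left (nhdsWithin_le_nhds (s := {0}ᶜ))
    simp only [abs_zero, Real.zero_rpow (by linarith : p - 1 ≠ 0), zero_mul, mul_zero] at h ⊢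
    refine h.congr' ?_
    filter_upwards [self_mem_nhdsWithin] with t ht
    have ht : t ≠ 0 := ht
    rw [Real.zero_rpow (by linarith : p + 1 ≠ 0), zero_add, abs_mul,
      Real.mul_rpow (abs_nonneg _) (abs_nonneg _), ← abs_rpow_sub_one_mul_sq hp t]
    field_simp
    ring
  · have hx : Tendsto (fun t : ℝ => t * (b / a)) (𝓝[≠] 0) (𝓝[≠] 0) := by
      refine tendsto_nhdsWithin_iff.mpr ⟨?_, ?_⟩
      · have : ContinuousAt (fun t : ℝ => t * (b / a)) 0 := by fun_prop
        simpa using this.tendsto.mono_left (nhdsWithin_le_nhds (s := {0}ᶜ))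
      · filter_upwards [self_mem_nhdsWithin] with t ht
        exact mul_ne_zero ht (div_ne_zero hb ha)
    have h := ((tendsto_rpow_second_quotient (p + 1)).comp hx).const_mul
      (|a| ^ (p - 1) * b ^ 2)
    have h' : |a| ^ (p - 1) * b ^ 2 * ((p + 1) * (p + 1 - 1) / 2)
      = (p + 1) * p / 2 * (|a| ^ (p - 1) * b ^ 2) := by ring
    rw [h'] at h
    refine h.congr' ?_
    filter_upwards [self_mem_nhdsWithin] with t ht
    have ht : t ≠ 0 := ht
    have h2 : |a + t * b| ^ (p + 1) = |a| ^ (p - 1) * a ^ 2 * |1 + t * (b / a)| ^ (p + 1) := by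
      rw [abs_rpow_sub_one_mul_sq hp, ← Real.mul_rpow (abs_nonneg _) (abs_nonneg _), ← abs_mul]
      congr 2
      field_simp
    rw [h2, ← abs_rpow_sub_one_mul_sq hp a]
    simp only [Function.comp_apply]
    field_simp

/-- Replace each factor by the largest of |a|, |b|, |c|. This plays the role of Hölder's inequality
for the integrability of the weighted products. -/
lemma abs_rpow_mul_mul_le {p : ℝ} (hp : 1 < p) (a b c : ℝ) :
    |a| ^ (p - 1) * |b| * |c| ≤ |a| ^ (p + 1) + |b| ^ (p + 1) + |c| ^ (p + 1) := by
  have h1 : 0 ≤ |a| ^ (p + 1) := by positivity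
  have h2 : 0 ≤ |b| ^ (p + 1) := by positivity
  have h3 : 0 ≤ |c| ^ (p + 1) := by positivity
  have key (d : ℝ) (ha : |a| ≤ |d|) (hb : |b| ≤ |d|) (hc : |c| ≤ |d|) :
      |a| ^ (p - 1) * |b| * |c| ≤ |d| ^ (p + 1) := by
    rw [← abs_rpow_sub_one_mul_sq hp d, ← sq_abs d, sq, ← mul_assoc]
    have : |a| ^ (p - 1) ≤ |d| ^ (p - 1) :=
      Real.rpow_le_rpow (abs_nonneg _) ha (by linarith)
    gcongr
  rcases le_total |a| |b| with hab | hab <;> rcases le_total |b| |c| with hbc | hbc <;>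
    rcases le_total |a| |c| with hac | hac
  all_goals first
    | linarith [key a le_rfl hab hac]
    | linarith [key b hab le_rfl hbc]
    | linarith [key c hac hbc le_rfl]
    | linarith [key c (hab.trans hbc) hbc le_rfl]
    | linarith [key a le_rfl hab (hbc.trans hab)]

/-! ### A form of Fatou's lemma -/

/-- No dominating function is required: the convergent bounds `R n` control the lower limit.
Integrability of the limit is part of the conclusion, since without it the integral would carry no
information. -/
lemma integrable_and_integral_le_of_tendsto {α : Type*} [MeasurableSpace α] {μ : Measure α}
    {G : ℕ → α → ℝ} {g : α → ℝ} {R : ℕ → ℝ} {r : ℝ} (hG : ∀ n, Integrable (G n) μ)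
    (hG0 : ∀ n, 0 ≤ᵐ[μ] G n) (hlim : ∀ᵐ x ∂μ, Tendsto (fun n => G n x) atTop (𝓝 (g x)))
    (hR : ∀ n, ∫ x, G n x ∂μ ≤ R n) (hr : Tendsto R atTop (𝓝 r)) :
    Integrable g μ ∧ ∫ x, g x ∂μ ≤ r := by
  have hgm : AEStronglyMeasurable g μ :=
    aestronglyMeasurable_of_tendsto_ae atTop (fun n => (hG n).aestronglyMeasurable) hlim
  have hg0 : 0 ≤ᵐ[μ] g := by
    filter_upwards [hlim, ae_all_iff.mpr hG0] with x hx h0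
    exact ge_of_tendsto' hx h0
  have hr0 : 0 ≤ r :=
    ge_of_tendsto' hr fun n => (integral_nonneg_of_ae (hG0 n)).trans (hR n)
  have key : ∫⁻ x, ENNReal.ofReal (g x) ∂μ ≤ ENNReal.ofReal r := by
    calc ∫⁻ x, ENNReal.ofReal (g x) ∂μ
        = ∫⁻ x, liminf (fun n => ENNReal.ofReal (G n x)) atTop ∂μ := by
          refine lintegral_congr_ae ?_
          filter_upwards [hlim] with x hx
          exact ((ENNReal.continuous_ofReal.tendsto _).comp hx).liminf_eq.symm
      _ ≤ liminf (fun n => ∫⁻ x, ENNReal.ofReal (G n x) ∂μ) atTop :=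
          lintegral_liminf_le' fun n => (hG n).aestronglyMeasurable.aemeasurable.ennreal_ofReal
      _ ≤ liminf (fun n => ENNReal.ofReal (R n)) atTop := by
          refine liminf_le_liminf (Eventually.of_forall fun n => ?_)
          rw [← ofReal_integral_eq_lintegral_ofReal (hG n) (hG0 n)]
          exact ENNReal.ofReal_le_ofReal (hR n)
      _ = ENNReal.ofReal r := ((ENNReal.continuous_ofReal.tendsto _).comp hr).liminf_eq
  have hgi : Integrable g μ := by
    refine ⟨hgm, ?_⟩
    rw [hasFiniteIntegral_iff_ofReal hg0]
    exact key.trans_lt ENNReal.ofReal_lt_top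
  refine ⟨hgi, ?_⟩
  rw [← ofReal_integral_eq_lintegral_ofReal hgi hg0] at key
  exact (ENNReal.ofReal_le_ofReal_iff hr0).mp key

/-! ### Bilinearity of the Gagliardo form -/

lemma FiniteGagliardo.integrable_mul {s : ℝ} {u v : L2 N} (hu : FiniteGagliardo s u)
    (hv : FiniteGagliardo s v) :
    Integrable (fun z : EuclideanSpace ℝ (Fin N) × EuclideanSpace ℝ (Fin N) =>
      (u z.1 - u z.2) * (v z.1 - v z.2) / ‖z.1 - z.2‖ ^ ((N : ℝ) + 2 * s)) volume := by
  have hum := (Lp.stronglyMeasurable u).measurable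
  have hvm := (Lp.stronglyMeasurable v).measurable
  have hm : Measurable (fun z : EuclideanSpace ℝ (Fin N) × EuclideanSpace ℝ (Fin N) =>
      (u z.1 - u z.2) * (v z.1 - v z.2) / ‖z.1 - z.2‖ ^ ((N : ℝ) + 2 * s)) := by fun_prop
  refine (Integrable.add hu hv).mono' hm.aestronglyMeasurable (Eventually.of_forall fun z => ?_)
  have hn : 0 ≤ ‖z.1 - z.2‖ ^ ((N : ℝ) + 2 * s) := by positivity
  rw [norm_div, Real.norm_of_nonneg hn, Pi.add_apply, ← add_div, Real.norm_eq_abs, abs_mul]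
  apply div_le_div_of_nonneg_right _ hn
  nlinarith [sq_nonneg (|u z.1 - u z.2| - |v z.1 - v z.2|), sq_abs (u z.1 - u z.2),
    sq_abs (v z.1 - v z.2), sq_nonneg (u z.1 - u z.2), sq_nonneg (v z.1 - v z.2)]

lemma gagliardoInner_comm (s : ℝ) (u v : L2 N) : gagliardoInner s u v = gagliardoInner s v u := by
  simp only [gagliardoInner, mul_comm]

lemma gagliardoInner_add_left {s : ℝ} {u v φ : L2 N} (hu : FiniteGagliardo s u)
    (hv : FiniteGagliardo s v) (hφ : FiniteGagliardo s φ) :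
    gagliardoInner s (u + v) φ = gagliardoInner s u φ + gagliardoInner s v φ := by
  unfold gagliardoInner
  rw [← integral_add (hu.integrable_mul hφ) (hv.integrable_mul hφ)]
  refine integral_congr_ae ?_
  filter_upwards [ae_prod_of_ae (Lp.coeFn_add u v)] with z hz
  simp only [hz.1, hz.2, Pi.add_apply]
  ring

lemma gagliardoInner_smul_left (s c : ℝ) (u φ : L2 N) :
    gagliardoInner s (c • u) φ = c * gagliardoInner s u φ := by
  unfold gagliardoInner
  rw [← integral_const_mul]
  refine integral_congr_ae ?_
  filter_upwards [ae_prod_of_ae (Lp.coeFn_smul c u)] with z hz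
  simp only [hz.1, hz.2, Pi.smul_apply, smul_eq_mul]
  ring

lemma gagliardoInner_add_smul_self {Ω : Set (EuclideanSpace ℝ (Fin N))} {s : ℝ} {u v : L2 N}
    (hu : u ∈ Hs0 Ω s) (hv : v ∈ Hs0 Ω s) (t : ℝ) :
    gagliardoInner s (u + t • v) (u + t • v) = gagliardoInner s u u
      + 2 * t * gagliardoInner s u v + t ^ 2 * gagliardoInner s v v := by
  have htv := ((Hs0 Ω s).smul_mem t hv).2
  have hsum := ((Hs0 Ω s).add_mem hu ((Hs0 Ω s).smul_mem t hv)).2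
  rw [gagliardoInner_add_left hu.2 htv hsum, gagliardoInner_comm s u, gagliardoInner_smul_left,
    gagliardoInner_comm s v, gagliardoInner_add_left hu.2 htv hu.2,
    gagliardoInner_add_left hu.2 htv hv.2, gagliardoInner_smul_left, gagliardoInner_smul_left,
    gagliardoInner_comm s v u]
  ring

/-! ### Integrals over the domain -/

lemma integrable_mul_L2 (v φ : L2 N) : Integrable (fun x => v x * φ x) :=
  (Lp.memLp v).integrable_mul (Lp.memLp φ)

lemma integrableOn_abs_rpow_mul_mul {Ω : Set (EuclideanSpace ℝ (Fin N))} {p : ℝ} (hp : 1 < p)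
    {u v φ : L2 N} (hu : IntegrableOn (fun x => |u x| ^ (p + 1)) Ω)
    (hv : IntegrableOn (fun x => |v x| ^ (p + 1)) Ω)
    (hφ : IntegrableOn (fun x => |φ x| ^ (p + 1)) Ω) :
    IntegrableOn (fun x => |u x| ^ (p - 1) * v x * φ x) Ω := by
  have hum := (Lp.stronglyMeasurable u).measurable
  have hvm := (Lp.stronglyMeasurable v).measurable
  have hφm := (Lp.stronglyMeasurable φ).measurable
  have hm : Measurable fun x => |u x| ^ (p - 1) * v x * φ x := by fun_prop
  refine Integrable.mono' ((hu.add hv).add hφ) hm.aestronglyMeasurable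
    (Eventually.of_forall fun x => ?_)
  have h0 : 0 ≤ |u x| ^ (p - 1) := by positivity
  rw [Real.norm_eq_abs, abs_mul, abs_mul, abs_of_nonneg h0]
  exact abs_rpow_mul_mul_le hp _ _ _

/-- If the integral vanished, `v` would be zero a.e. in Ω, and it already is outside. -/
lemma setIntegral_sq_pos {Ω : Set (EuclideanSpace ℝ (Fin N))} (hΩ : MeasurableSet Ω) {s : ℝ}
    {v : L2 N} (hv : v ∈ Hs0 Ω s) (hv0 : v ≠ 0) : 0 < ∫ x in Ω, v x * v x := by
  have h0 : 0 ≤ᵐ[volume.restrict Ω] fun x => v x * v x :=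
    Eventually.of_forall fun x => mul_self_nonneg _
  refine (integral_nonneg_of_ae h0).lt_of_ne fun h => hv0 ?_
  have h1 := (integral_eq_zero_iff_of_nonneg_ae h0 (integrable_mul_L2 v v).integrableOn).mp h.symm
  rw [EventuallyEq, ae_restrict_iff' hΩ] at h1
  refine Lp.eq_zero_iff_ae_eq_zero.mpr ?_
  filter_upwards [h1, hv.1] with x h1 h2
  by_cases hx : x ∈ Ω
  · simpa using h1 hx
  · simpa using h2 hx

lemma energy_smul (Ω : Set (EuclideanSpace ℝ (Fin N))) (s lam c : ℝ) (v : L2 N) :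
    energy Ω s lam (c • v) = c ^ 2 * energy Ω s lam v := by
  have h : ∫ x in Ω, (c • v) x ^ 2 = c ^ 2 * ∫ x in Ω, v x ^ 2 := by
    rw [← integral_const_mul]
    refine integral_congr_ae ?_
    filter_upwards [ae_restrict_of_ae (Lp.coeFn_smul c v)] with x hx
    rw [hx, Pi.smul_apply, smul_eq_mul]
    ring
  rw [energy, energy, h, gagliardoInner_smul_left, gagliardoInner_comm, gagliardoInner_smul_left]
  ring

lemma setIntegral_abs_smul_rpow (Ω : Set (EuclideanSpace ℝ (Fin N))) (q c : ℝ) (v : L2 N) :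
    ∫ x in Ω, |(c • v) x| ^ q = |c| ^ q * ∫ x in Ω, |v x| ^ q := by
  rw [← integral_const_mul]
  refine integral_congr_ae ?_
  filter_upwards [ae_restrict_of_ae (Lp.coeFn_smul c v)] with x hx
  rw [hx, Pi.smul_apply, smul_eq_mul, abs_mul, Real.mul_rpow (abs_nonneg _) (abs_nonneg _)]

/-- Scale-invariant form of minimality: normalize `v` to satisfy the constraint and use that Φ is
homogeneous of degree 2. The condition `hI` also forces |v|^(p+1) to be integrable on Ω. -/
lemma IsConstrainedMinimizer.energy_mul_rpow_le {Ω : Set (EuclideanSpace ℝ (Fin N))}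
    {s lam p : ℝ} (hp : 1 < p) {w : L2 N} (hw : IsConstrainedMinimizer Ω s lam p w) {v : L2 N}
    (hv : v ∈ Hs0 Ω s) (hI : 0 < ∫ x in Ω, |v x| ^ (p + 1)) :
    energy Ω s lam w * (∫ x in Ω, |v x| ^ (p + 1)) ^ (2 / (p + 1)) ≤ energy Ω s lam v := by
  set I := ∫ x in Ω, |v x| ^ (p + 1) with hIdef
  have hp1 : p + 1 ≠ 0 := by linarith
  set a := I ^ (-(1 / (p + 1))) with ha
  have ha0 : 0 < a := Real.rpow_pos_of_pos hI _
  have h1 : ∫ x in Ω, |(a • v) x| ^ (p + 1) = 1 := by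
    rw [setIntegral_abs_smul_rpow, ← hIdef, abs_of_pos ha0, ha, ← Real.rpow_mul hI.le,
      show -(1 / (p + 1)) * (p + 1) = -1 by field_simp, Real.rpow_neg_one, inv_mul_cancel₀ hI.ne']
  have h2 := hw.2.2 (a • v) ((Hs0 Ω s).smul_mem a hv) h1
  rw [energy_smul] at h2
  have h3 : a ^ 2 * I ^ (2 / (p + 1)) = 1 := by
    rw [ha, ← Real.rpow_natCast, ← Real.rpow_mul hI.le, ← Real.rpow_add hI]
    convert Real.rpow_zero I using 2
    push_cast
    ring
  have h4 : 0 < I ^ (2 / (p + 1)) := Real.rpow_pos_of_pos hI _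
  calc energy Ω s lam w * I ^ (2 / (p + 1))
      ≤ a ^ 2 * energy Ω s lam v * I ^ (2 / (p + 1)) := mul_le_mul_of_nonneg_right h2 h4.le
    _ = (a ^ 2 * I ^ (2 / (p + 1))) * energy Ω s lam v := by ring
    _ = energy Ω s lam v := by rw [h3, one_mul]

/-! ### Truncation -/

/-- Truncation of a real number at the levels `-k` and `k`. -/
def clip (k x : ℝ) : ℝ := max (-k) (min x k)

lemma lipschitzWith_clip (k : ℝ) : LipschitzWith 1 (clip k) :=
  (LipschitzWith.id.min_const k).const_max (-k)

lemma clip_zero {k : ℝ} (hk : 0 ≤ k) : clip k 0 = 0 := by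
  simp [clip, hk]

lemma abs_clip_le {k : ℝ} (hk : 0 ≤ k) (x : ℝ) : |clip k x| ≤ k :=
  abs_le.mpr ⟨le_max_left _ _, max_le (by linarith) (min_le_right _ _)⟩

lemma clip_eq_self {k x : ℝ} (h : |x| ≤ k) : clip k x = x := by
  rw [clip, min_eq_left (abs_le.mp h).2, max_eq_right (abs_le.mp h).1]

lemma abs_clip_sub_le (k x y : ℝ) : |clip k x - clip k y| ≤ |x - y| := by
  simpa [Real.dist_eq] using (lipschitzWith_clip k).dist_le_mul x y

/-- Truncation of a function of `L²` at the levels `-k` and `k`. -/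
noncomputable def clipL2 (k : ℕ) (v : L2 N) : L2 N :=
  (lipschitzWith_clip (k : ℝ)).compLp (clip_zero k.cast_nonneg) v

lemma coeFn_clipL2 (k : ℕ) (v : L2 N) : ∀ᵐ x, clipL2 k v x = clip k (v x) :=
  LipschitzWith.coeFn_compLp _ _ _

/-- Truncation is 1-Lipschitz, so it does not increase differences. -/
lemma clip_quotient_le (s : ℝ) (k : ℕ) (v : L2 N) :
    ∀ᵐ z : EuclideanSpace ℝ (Fin N) × EuclideanSpace ℝ (Fin N),
      (clipL2 k v z.1 - clipL2 k v z.2) ^ 2 / ‖z.1 - z.2‖ ^ ((N : ℝ) + 2 * s)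
        ≤ (v z.1 - v z.2) ^ 2 / ‖z.1 - z.2‖ ^ ((N : ℝ) + 2 * s) := by
  filter_upwards [ae_prod_of_ae (coeFn_clipL2 k v)] with z hz
  rw [hz.1, hz.2]
  exact div_le_div_of_nonneg_right (sq_le_sq.mpr (abs_clip_sub_le _ _ _)) (by positivity)

lemma clipL2_mem_Hs0 {Ω : Set (EuclideanSpace ℝ (Fin N))} {s : ℝ} (k : ℕ) {v : L2 N}
    (hv : v ∈ Hs0 Ω s) : clipL2 k v ∈ Hs0 Ω s := by
  refine ⟨?_, ?_⟩
  · filter_upwards [coeFn_clipL2 k v, hv.1] with x hx h0 hxΩ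
    rw [hx, h0 hxΩ, clip_zero k.cast_nonneg]
  · refine Integrable.mono' hv.2 (aestronglyMeasurable_gagliardo s _) ?_
    filter_upwards [clip_quotient_le s k v] with z hz
    rwa [Real.norm_of_nonneg (by positivity)]

/-- The bound is uniform in `k`, which Fatou's lemma needs as k → ∞; |lam| appears because `lam` may
have either sign. -/
lemma energy_clipL2_le {Ω : Set (EuclideanSpace ℝ (Fin N))} {s : ℝ} (lam : ℝ) (k : ℕ) {v : L2 N}
    (hv : v ∈ Hs0 Ω s) :
    energy Ω s lam (clipL2 k v) ≤ gagliardoInner s v v + |lam| * ∫ x in Ω, v x ^ 2 := by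
  have h1 : gagliardoInner s (clipL2 k v) (clipL2 k v) ≤ gagliardoInner s v v := by
    simp only [gagliardoInner, ← sq]
    exact integral_mono_ae (clipL2_mem_Hs0 k hv).2 hv.2 (clip_quotient_le s k v)
  have hsq (f : L2 N) : IntegrableOn (fun x => f x ^ 2) Ω := by
    simpa only [sq] using (integrable_mul_L2 f f).integrableOn
  have h2 : ∫ x in Ω, clipL2 k v x ^ 2 ≤ ∫ x in Ω, v x ^ 2 := by
    refine integral_mono_ae (hsq _) (hsq _) ?_
    filter_upwards [ae_restrict_of_ae (coeFn_clipL2 k v)] with x hx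
    rw [hx]
    refine sq_le_sq.mpr ?_
    simpa [clip_zero k.cast_nonneg] using abs_clip_sub_le k (v x) 0
  have h3 : 0 ≤ ∫ x in Ω, clipL2 k v x ^ 2 := integral_nonneg fun x => sq_nonneg _
  rw [energy]
  nlinarith [neg_abs_le lam, abs_nonneg lam, mul_le_mul_of_nonneg_left h2 (abs_nonneg lam)]

/-- A constrained minimizer of positive energy provides the embedding of `H^s_0(Ω)` into
`L^(p+1)(Ω)`. -/
lemma IsConstrainedMinimizer.integrableOn_abs_rpow {Ω : Set (EuclideanSpace ℝ (Fin N))}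
    (hΩb : Bornology.IsBounded Ω) {s lam p : ℝ} (hp : 1 < p) {w : L2 N}
    (hw : IsConstrainedMinimizer Ω s lam p w) (hpos : 0 < energy Ω s lam w) {v : L2 N}
    (hv : v ∈ Hs0 Ω s) : IntegrableOn (fun x => |v x| ^ (p + 1)) Ω := by
  set C := gagliardoInner s v v + |lam| * ∫ x in Ω, v x ^ 2 with hC
  have hfin : volume Ω ≠ ⊤ := hΩb.measure_lt_top.ne
  -- A truncation is bounded and Ω has finite measure.
  have hlip (k : ℕ) : IntegrableOn (fun x => |clipL2 k v x| ^ (p + 1)) Ω := by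
    have hm := (Lp.stronglyMeasurable (clipL2 k v)).measurable
    have hm' : Measurable fun x => |clipL2 k v x| ^ (p + 1) := by fun_prop
    refine Integrable.mono' (integrableOn_const (C := (k : ℝ) ^ (p + 1)) hfin)
      hm'.aestronglyMeasurable ?_
    filter_upwards [ae_restrict_of_ae (coeFn_clipL2 k v)] with x hx
    rw [Real.norm_of_nonneg (by positivity), hx]
    exact Real.rpow_le_rpow (abs_nonneg _) (abs_clip_le k.cast_nonneg _) (by linarith)
  refine (integrable_and_integral_le_of_tendsto (G := fun k x => |clipL2 k v x| ^ (p + 1))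
    (R := fun _ => (C / energy Ω s lam w) ^ ((p + 1) / 2)) hlip
    (fun k => Eventually.of_forall fun x => by positivity) ?_ ?_ tendsto_const_nhds).1
  · filter_upwards [ae_restrict_of_ae (ae_all_iff.mpr fun k => coeFn_clipL2 k v)] with x hx
    refine tendsto_const_nhds.congr' ?_
    -- At a fixed point the truncations equal `v x` as soon as `k` exceeds |v x|.
    filter_upwards [eventually_ge_atTop ⌈|v x|⌉₊] with k hk
    rw [hx, clip_eq_self (Nat.ceil_le.mp hk)]
  · intro k
    have hC0 : 0 ≤ C := add_nonneg
      (integral_nonneg fun z => div_nonneg (mul_self_nonneg _) (by positivity))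
      (mul_nonneg (abs_nonneg _) (integral_nonneg fun x => sq_nonneg _))
    -- The minimality inequality requires a positive integral, so the zero case is separate.
    rcases (integral_nonneg fun x => by positivity :
        0 ≤ ∫ x in Ω, |clipL2 k v x| ^ (p + 1)).eq_or_lt with h | h
    · rw [← h]
      exact Real.rpow_nonneg (div_nonneg hC0 hpos.le) _
    · have h1 := (hw.energy_mul_rpow_le hp (clipL2_mem_Hs0 k hv) h).trans
        (energy_clipL2_le lam k hv)
      rw [← hC, ← le_div_iff₀' hpos] at h1
      have h2 := Real.rpow_le_rpow (by positivity) h1 (by linarith : 0 ≤ (p + 1) / 2)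
      rwa [← Real.rpow_mul h.le, show 2 / (p + 1) * ((p + 1) / 2) = 1 by
        have : p + 1 ≠ 0 := by linarith
        field_simp, Real.rpow_one] at h2

/-! ### The second variation at a constrained minimizer -/

lemma coeFn_add_smul (u v : L2 N) (t : ℝ) : ∀ᵐ x, (u + t • v) x = u x + t * v x := by
  filter_upwards [Lp.coeFn_add u (t • v), Lp.coeFn_smul t v] with x h1 h2
  rw [h1, Pi.add_apply, h2, Pi.smul_apply, smul_eq_mul]

lemma setIntegral_add_smul_mul_self {Ω : Set (EuclideanSpace ℝ (Fin N))}
    {V : EuclideanSpace ℝ (Fin N) → ℝ} {u v : L2 N}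
    (huu : IntegrableOn (fun x => V x * u x * u x) Ω)
    (huv : IntegrableOn (fun x => V x * u x * v x) Ω)
    (hvv : IntegrableOn (fun x => V x * v x * v x) Ω) (t : ℝ) :
    ∫ x in Ω, V x * (u + t • v) x * (u + t • v) x = (∫ x in Ω, V x * u x * u x)
      + 2 * t * (∫ x in Ω, V x * u x * v x) + t ^ 2 * ∫ x in Ω, V x * v x * v x := by
  have h1 : IntegrableOn (fun x => V x * u x * u x + 2 * t * (V x * u x * v x)) Ω :=
    huu.add (huv.const_mul (2 * t))
  rw [← integral_const_mul, ← integral_const_mul, ← integral_add huu (huv.const_mul (2 * t)),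
    ← integral_add h1 (hvv.const_mul (t ^ 2))]
  refine integral_congr_ae ?_
  filter_upwards [ae_restrict_of_ae (coeFn_add_smul u v t)] with x hx
  rw [hx]
  ring

/-- The hypothesis `horth` says that `u` and `v` are orthogonal for the bilinear form of Φ, so the
expansion has no linear term. -/
lemma energy_add_smul {Ω : Set (EuclideanSpace ℝ (Fin N))} {s lam : ℝ} {u v : L2 N}
    (hu : u ∈ Hs0 Ω s) (hv : v ∈ Hs0 Ω s)
    (horth : gagliardoInner s u v = lam * ∫ x in Ω, u x * v x) (t : ℝ) :
    energy Ω s lam (u + t • v) = energy Ω s lam u + t ^ 2 * energy Ω s lam v := by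
  have h := setIntegral_add_smul_mul_self (Ω := Ω) (V := fun _ => 1) (u := u) (v := v)
    (by simpa using (integrable_mul_L2 u u).integrableOn)
    (by simpa using (integrable_mul_L2 u v).integrableOn)
    (by simpa using (integrable_mul_L2 v v).integrableOn) t
  simp only [one_mul, ← sq] at h
  rw [energy, energy, energy, gagliardoInner_add_smul_self hu hv, h, horth]
  ring

lemma tendsto_one_add_mul_rpow_quotient (A r : ℝ) :
    Tendsto (fun y : ℝ => ((1 + y * A) ^ r - 1) / y) (𝓝[≠] 0) (𝓝 (r * A)) := by
  have hd : HasDerivAt (fun y : ℝ => (1 + y * A) ^ r) (r * A) 0 := by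
    have h := (((hasDerivAt_id (0 : ℝ)).mul_const A).const_add 1).rpow_const (p := r)
      (Or.inl (by simp))
    simpa [mul_comm] using h
  refine hd.tendsto_slope.congr fun y => ?_
  simp [slope_def_field]

/-- Comparing `w` with `w + t • v`, unnormalized, in the scale-invariant inequality avoids building
a curve inside the constraint set. Fatou's lemma suffices, as only an upper bound for the
second-order term is wanted. -/
lemma IsConstrainedMinimizer.second_variation {Ω : Set (EuclideanSpace ℝ (Fin N))}
    (hΩb : Bornology.IsBounded Ω) {s lam p : ℝ} (hp : 1 < p) {w : L2 N}
    (hw : IsConstrainedMinimizer Ω s lam p w) (hpos : 0 < energy Ω s lam w) {v : L2 N}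
    (hv : v ∈ Hs0 Ω s) (htan : ∫ x in Ω, |w x| ^ (p - 1) * w x * v x = 0)
    (horth : gagliardoInner s w v = lam * ∫ x in Ω, w x * v x) :
    p * energy Ω s lam w * ∫ x in Ω, |w x| ^ (p - 1) * v x * v x ≤ energy Ω s lam v := by
  set E := energy Ω s lam w with hE
  set A := energy Ω s lam v / E with hA
  set t : ℕ → ℝ := fun n => 1 / ((n : ℝ) + 1) with ht
  have ht0 (n : ℕ) : 0 < t n := by positivity
  have htlim : Tendsto t atTop (𝓝[≠] 0) :=
    tendsto_nhdsWithin_iff.mpr ⟨tendsto_one_div_add_atTop_nhds_zero_nat,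
      Eventually.of_forall fun n => (ht0 n).ne'⟩
  have ht2lim : Tendsto (fun n => t n ^ 2) atTop (𝓝[≠] 0) := by
    refine tendsto_nhdsWithin_iff.mpr ⟨?_, Eventually.of_forall fun n => (pow_pos (ht0 n) 2).ne'⟩
    simpa using (tendsto_nhdsWithin_iff.mp htlim).1.pow 2
  have hint {f : L2 N} (hf : f ∈ Hs0 Ω s) : IntegrableOn (fun x => |f x| ^ (p + 1)) Ω :=
    hw.integrableOn_abs_rpow hΩb hp hpos hf
  have hmem (n : ℕ) : w + t n • v ∈ Hs0 Ω s :=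
    (Hs0 Ω s).add_mem hw.1 ((Hs0 Ω s).smul_mem _ hv)
  have hFi (n : ℕ) : IntegrableOn (fun x => |w x + t n * v x| ^ (p + 1)) Ω := by
    refine (hint (hmem n)).congr ?_
    filter_upwards [ae_restrict_of_ae (coeFn_add_smul w v (t n))] with x hx
    rw [hx]
  have hli (n : ℕ) : IntegrableOn (fun x => (p + 1) * (|w x| ^ (p - 1) * w x * (t n * v x))) Ω := by
    refine ((integrableOn_abs_rpow_mul_mul hp (hint hw.1) (hint hw.1) (hint hv)).const_mul
      ((p + 1) * t n)).congr (Eventually.of_forall fun x => ?_)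
    ring
  have hli0 (n : ℕ) : ∫ x in Ω, (p + 1) * (|w x| ^ (p - 1) * w x * (t n * v x)) = 0 := by
    rw [← mul_zero ((p + 1) * t n), ← htan, ← integral_const_mul]
    refine integral_congr_ae (Eventually.of_forall fun x => ?_)
    ring
  set F : ℕ → ℝ := fun n => ∫ x in Ω, |w x + t n * v x| ^ (p + 1) with hF
  have hFeq (n : ℕ) : F n = ∫ x in Ω, |(w + t n • v) x| ^ (p + 1) := by
    refine integral_congr_ae ?_
    filter_upwards [ae_restrict_of_ae (coeFn_add_smul w v (t n))] with x hx
    rw [hx]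
  set G : ℕ → EuclideanSpace ℝ (Fin N) → ℝ := fun n x => (|w x + t n * v x| ^ (p + 1)
    - |w x| ^ (p + 1) - (p + 1) * (|w x| ^ (p - 1) * w x * (t n * v x))) / t n ^ 2 with hG
  have hGi (n : ℕ) : IntegrableOn (G n) Ω := (((hFi n).sub (hint hw.1)).sub (hli n)).div_const _
  have hG0 (n : ℕ) : 0 ≤ᵐ[volume.restrict Ω] G n := Eventually.of_forall fun x => by
    have := abs_rpow_add_ge_tangent hp (w x) (t n * v x)
    exact div_nonneg (by linarith) (sq_nonneg _)
  have hGint (n : ℕ) : ∫ x in Ω, G n x = (F n - 1) / t n ^ 2 := by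
    have hd : IntegrableOn (fun x => |w x + t n * v x| ^ (p + 1) - |w x| ^ (p + 1)) Ω :=
      (hFi n).sub (hint hw.1)
    rw [hG, integral_div, integral_sub hd (hli n),
      integral_sub (hFi n) (hint hw.1), hli0, hw.2.1, sub_zero]
  -- The linear term integrates to zero, so convexity gives F n ≥ 1; in particular the minimality
  -- inequality applies to `w + t n • v`.
  have hF1 (n : ℕ) : 1 ≤ F n := by
    have h := integral_nonneg_of_ae (hG0 n)
    rw [hGint, div_nonneg_iff] at h
    rcases h with h | h
    · linarith [h.1]
    · exact absurd h.2 (not_le.mpr (pow_pos (ht0 n) 2))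
  have hR (n : ℕ) : ∫ x in Ω, G n x
      ≤ ((1 + t n ^ 2 * A) ^ ((p + 1) / 2) - 1) / t n ^ 2 := by
    rw [hGint]
    refine div_le_div_of_nonneg_right (sub_le_sub_right ?_ 1) (sq_nonneg _)
    have h0 : 0 < F n := by linarith [hF1 n]
    have h1 := hw.energy_mul_rpow_le hp (hmem n) (by rw [← hFeq]; exact h0)
    rw [← hFeq, energy_add_smul hw.1 hv horth, ← hE, ← le_div_iff₀' hpos] at h1
    have h2 : (E + t n ^ 2 * energy Ω s lam v) / E = 1 + t n ^ 2 * A := by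
      rw [hA]; field_simp
    rw [h2] at h1
    have h3 := Real.rpow_le_rpow (by positivity) h1 (by linarith : 0 ≤ (p + 1) / 2)
    rwa [← Real.rpow_mul h0.le, show 2 / (p + 1) * ((p + 1) / 2) = 1 by
      have : p + 1 ≠ 0 := by linarith
      field_simp, Real.rpow_one] at h3
  have key := (integrable_and_integral_le_of_tendsto hGi hG0
    (Eventually.of_forall fun x => (tendsto_abs_rpow_second_quotient hp (w x) (v x)).comp htlim)
    hR ((tendsto_one_add_mul_rpow_quotient A ((p + 1) / 2)).comp ht2lim)).2
  rw [integral_const_mul] at key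
  simp only [mul_assoc, ← sq] at key ⊢
  -- The limits on the two sides share the factor (p + 1)/2, which cancels.
  have h4 : p * ∫ x in Ω, |w x| ^ (p - 1) * v x ^ 2 ≤ A := by
    nlinarith
  rw [hA, le_div_iff₀ hpos] at h4
  linarith

/-- A nonintegrable function would have integral 0, not 1. -/
lemma IsConstrainedMinimizer.integrableOn_abs_rpow_self {Ω : Set (EuclideanSpace ℝ (Fin N))}
    {s lam p : ℝ} {w : L2 N} (hw : IsConstrainedMinimizer Ω s lam p w) :
    IntegrableOn (fun x => |w x| ^ (p + 1)) Ω := by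
  by_contra h
  exact zero_ne_one ((integral_undef h).symm.trans hw.2.1)

/-- Testing the equation of `c • w` with itself gives c² Φ(w) = c^(p+1). This supplies the
positivity of Φ(w). -/
lemma IsConstrainedMinimizer.energy_eq_rpow {Ω : Set (EuclideanSpace ℝ (Fin N))}
    {s lam p c : ℝ} (hp : 1 < p) {w : L2 N} (hw : IsConstrainedMinimizer Ω s lam p w)
    (hc : 0 < c) (hu : IsWeakSolution Ω s lam p (c • w)) :
    energy Ω s lam w = c ^ (p - 1) := by
  have hui : IntegrableOn (fun x => |(c • w) x| ^ (p + 1)) Ω := by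
    refine (hw.integrableOn_abs_rpow_self.const_mul (|c| ^ (p + 1))).congr ?_
    filter_upwards [ae_restrict_of_ae (Lp.coeFn_smul c w)] with x hx
    rw [hx, Pi.smul_apply, smul_eq_mul, abs_mul, Real.mul_rpow (abs_nonneg _) (abs_nonneg _)]
  have hsq : IntegrableOn (fun x => lam * (c • w) x ^ 2) Ω := by
    simpa only [sq] using ((integrable_mul_L2 (c • w) (c • w)).const_mul lam).integrableOn
  have h1 : energy Ω s lam (c • w) = ∫ x in Ω, |(c • w) x| ^ (p + 1) := by
    rw [energy, hu.2 _ hu.1, sub_eq_iff_eq_add', ← integral_const_mul, ← integral_add hsq hui]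
    refine integral_congr_ae (Eventually.of_forall fun x => ?_)
    simp only [← abs_rpow_sub_one_mul_sq hp]
    ring
  rw [energy_smul, setIntegral_abs_smul_rpow, hw.2.1, mul_one, abs_of_pos hc,
    show p + 1 = (p - 1) + 2 by ring, Real.rpow_add hc, Real.rpow_two, mul_comm] at h1
  exact mul_right_cancel₀ (pow_pos hc 2).ne' h1

lemma IsLeastEnergySolution.integrableOn_abs_rpow {Ω : Set (EuclideanSpace ℝ (Fin N))}
    (hΩb : Bornology.IsBounded Ω) {s lam p : ℝ} (hp : 1 < p) {u : L2 N}
    (hu : IsLeastEnergySolution Ω s lam p u) {v : L2 N} (hv : v ∈ Hs0 Ω s) :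
    IntegrableOn (fun x => |v x| ^ (p + 1)) Ω := by
  obtain ⟨hsol, c, w, hc, hw, rfl⟩ := hu
  refine hw.integrableOn_abs_rpow hΩb hp ?_ hv
  rw [hw.energy_eq_rpow hp hc hsol]
  exact Real.rpow_pos_of_pos hc _

/-- The weight p Φ(w) |w|^(p-1) is exactly p |u|^(p-1), because Φ(w) = c^(p-1). -/
lemma IsLeastEnergySolution.second_variation {Ω : Set (EuclideanSpace ℝ (Fin N))}
    (hΩb : Bornology.IsBounded Ω) {s lam p : ℝ} (hp : 1 < p) {u : L2 N}
    (hu : IsLeastEnergySolution Ω s lam p u) {v : L2 N} (hv : v ∈ Hs0 Ω s)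
    (htan : ∫ x in Ω, |u x| ^ (p - 1) * u x * v x = 0) :
    ∫ x in Ω, (p * |u x| ^ (p - 1) + lam) * v x * v x ≤ gagliardoInner s v v := by
  have hint {f : L2 N} (hf : f ∈ Hs0 Ω s) := hu.integrableOn_abs_rpow hΩb hp hf
  have hK := integrableOn_abs_rpow_mul_mul hp (hint hu.1.1) (hint hv) (hint hv)
  have hL := integrableOn_abs_rpow_mul_mul hp (hint hu.1.1) (hint hu.1.1) (hint hv)
  have hsplit : ∫ x in Ω, (p * |u x| ^ (p - 1) + lam) * v x * v x
      = p * (∫ x in Ω, |u x| ^ (p - 1) * v x * v x) + lam * ∫ x in Ω, v x ^ 2 := by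
    simp only [sq]
    rw [← integral_const_mul, ← integral_const_mul, ← integral_add (hK.const_mul p)
      ((integrable_mul_L2 v v).const_mul lam).integrableOn]
    exact integral_congr_ae (Eventually.of_forall fun x => by ring)
  -- Test the equation with `v`: the nonlinear term drops out by tangency.
  have horth : gagliardoInner s u v = lam * ∫ x in Ω, u x * v x := by
    rw [hu.1.2 v hv, ← add_zero (lam * _), ← htan, ← integral_const_mul,
      ← integral_add ((integrable_mul_L2 u v).const_mul lam).integrableOn hL]
    exact integral_congr_ae (Eventually.of_forall fun x => by ring)
  obtain ⟨hsol, c, w, hc, hw, rfl⟩ := hu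
  have hE := hw.energy_eq_rpow hp hc hsol
  have hcp : 0 < c ^ (p - 1) := Real.rpow_pos_of_pos hc _
  have hae : ∀ᵐ x ∂volume.restrict Ω, (c • w) x = c * w x := by
    filter_upwards [ae_restrict_of_ae (Lp.coeFn_smul c w)] with x hx using hx
  have habs (x : EuclideanSpace ℝ (Fin N)) :
      |c * w x| ^ (p - 1) = c ^ (p - 1) * |w x| ^ (p - 1) := by
    rw [abs_mul, Real.mul_rpow (abs_nonneg _) (abs_nonneg _), abs_of_pos hc]
  have htan' : ∫ x in Ω, |w x| ^ (p - 1) * w x * v x = 0 := by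
    have h : ∫ x in Ω, |(c • w) x| ^ (p - 1) * (c • w) x * v x
        = c ^ (p - 1) * c * ∫ x in Ω, |w x| ^ (p - 1) * w x * v x := by
      rw [← integral_const_mul]
      refine integral_congr_ae ?_
      filter_upwards [hae] with x hx
      rw [hx, habs]
      ring
    rw [htan] at h
    exact (mul_eq_zero.mp h.symm).resolve_left (by positivity)
  have horth' : gagliardoInner s w v = lam * ∫ x in Ω, w x * v x := by
    have h : ∫ x in Ω, (c • w) x * v x = c * ∫ x in Ω, w x * v x := by
      rw [← integral_const_mul]
      refine integral_congr_ae ?_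
      filter_upwards [hae] with x hx
      rw [hx, mul_assoc]
    rw [gagliardoInner_smul_left, h, mul_left_comm] at horth
    exact mul_left_cancel₀ hc.ne' horth
  have key := hw.second_variation hΩb hp (hE ▸ hcp) hv htan' horth'
  have hKw : ∫ x in Ω, |(c • w) x| ^ (p - 1) * v x * v x
      = c ^ (p - 1) * ∫ x in Ω, |w x| ^ (p - 1) * v x * v x := by
    rw [← integral_const_mul]
    refine integral_congr_ae ?_
    filter_upwards [hae] with x hx
    rw [hx, habs]
    ring
  rw [hsplit, hKw]
  rw [hE, energy] at key
  linarith

/-! ### The Morse index -/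

lemma IsLeastEnergySolution.integrableOn_linearized {Ω : Set (EuclideanSpace ℝ (Fin N))}
    (hΩb : Bornology.IsBounded Ω) {s lam p : ℝ} (hp : 1 < p) {u : L2 N}
    (hu : IsLeastEnergySolution Ω s lam p u) {v φ : L2 N} (hv : v ∈ Hs0 Ω s) (hφ : φ ∈ Hs0 Ω s) :
    IntegrableOn (fun x => (p * |u x| ^ (p - 1) + lam) * v x * φ x) Ω := by
  have hint {f : L2 N} (hf : f ∈ Hs0 Ω s) := hu.integrableOn_abs_rpow hΩb hp hf
  refine (((integrableOn_abs_rpow_mul_mul hp (hint hu.1.1) (hint hv) (hint hφ)).const_mul p).add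
    ((integrable_mul_L2 v φ).const_mul lam).integrableOn).congr
    (Filter.Eventually.of_forall fun x => ?_)
  simp only [Pi.add_apply]
  ring

/-- Otherwise some nonzero combination of `v₁` and `v₂` is tangent to the constraint, while the
linearized form is negative on it. -/
lemma IsLeastEnergySolution.mem_span_singleton {Ω : Set (EuclideanSpace ℝ (Fin N))}
    (hΩ : MeasurableSet Ω) (hΩb : Bornology.IsBounded Ω) {s lam p : ℝ} (hp : 1 < p) {u : L2 N}
    (hu : IsLeastEnergySolution Ω s lam p u) {m₁ m₂ : ℝ} {v₁ v₂ : L2 N} (hm₁ : m₁ < 0)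
    (hm₂ : m₂ < 0) (h₁ : IsLinearizedEigenfunction Ω s lam p u m₁ v₁)
    (h₂ : IsLinearizedEigenfunction Ω s lam p u m₂ v₂) : v₂ ∈ Submodule.span ℝ {v₁} := by
  by_contra hspan
  have hint {f : L2 N} (hf : f ∈ Hs0 Ω s) := hu.integrableOn_abs_rpow hΩb hp hf
  have hlin {f : L2 N} (hf : f ∈ Hs0 Ω s) :=
    integrableOn_abs_rpow_mul_mul hp (hint hu.1.1) (hint hu.1.1) (hint hf)
  have hp₁ := setIntegral_sq_pos hΩ h₁.1 h₁.2.1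
  have hp₂ := setIntegral_sq_pos hΩ h₂.1 h₂.2.1
  have e₁₁ := h₁.2.2 v₁ h₁.1
  have e₂₂ := h₂.2.2 v₂ h₂.1
  have e₂₁ := h₂.2.2 v₁ h₁.1
  -- Symmetry of the linearized form: eigenfunctions of distinct eigenvalues are orthogonal in
  -- L²(Ω).
  have e₁₂ : m₁ * ∫ x in Ω, v₂ x * v₁ x = m₂ * ∫ x in Ω, v₂ x * v₁ x := by
    have hc : ∫ x in Ω, v₂ x * v₁ x = ∫ x in Ω, v₁ x * v₂ x := by simp only [mul_comm]
    rw [← e₂₁, hc, ← h₁.2.2 v₂ h₂.1, gagliardoInner_comm]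
    simp only [mul_right_comm]
  -- A tangent `v₁` would have form value m₁ ∫ v₁² < 0, against the second variation.
  have hA : ∫ x in Ω, |u x| ^ (p - 1) * u x * v₁ x ≠ 0 := by
    intro h0
    have h := hu.second_variation hΩb hp h₁.1 h0
    nlinarith
  set A := ∫ x in Ω, |u x| ^ (p - 1) * u x * v₁ x with hAdef
  set B := ∫ x in Ω, |u x| ^ (p - 1) * u x * v₂ x with hBdef
  -- The coefficient that makes `v₂ + t • v₁` tangent.
  set t := -(B / A) with ht
  have hz : v₂ + t • v₁ ∈ Hs0 Ω s := (Hs0 Ω s).add_mem h₂.1 ((Hs0 Ω s).smul_mem t h₁.1)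
  have hz0 : v₂ + t • v₁ ≠ 0 := by
    intro h
    refine hspan (Submodule.mem_span_singleton.mpr ⟨-t, ?_⟩)
    rw [neg_smul]
    exact (eq_neg_of_add_eq_zero_left h).symm
  have htan : ∫ x in Ω, |u x| ^ (p - 1) * u x * (v₂ + t • v₁) x = 0 := by
    have h : ∫ x in Ω, |u x| ^ (p - 1) * u x * (v₂ + t • v₁) x = B + t * A := by
      rw [hAdef, hBdef, ← integral_const_mul, ← integral_add (hlin h₂.1) ((hlin h₁.1).const_mul t)]
      refine integral_congr_ae ?_
      filter_upwards [ae_restrict_of_ae (coeFn_add_smul v₂ v₁ t)] with x hx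
      rw [hx]
      ring
    rw [h, ht]
    field_simp
    ring
  have hQ := hu.second_variation hΩb hp hz htan
  rw [gagliardoInner_add_smul_self h₂.1 h₁.1, setIntegral_add_smul_mul_self
    (V := fun x => p * |u x| ^ (p - 1) + lam) (hu.integrableOn_linearized hΩb hp h₂.1 h₂.1)
    (hu.integrableOn_linearized hΩb hp h₂.1 h₁.1)
    (hu.integrableOn_linearized hΩb hp h₁.1 h₁.1)] at hQ
  have hpz := setIntegral_sq_pos hΩ hz hz0
  have hsq := setIntegral_add_smul_mul_self (Ω := Ω) (V := fun _ => 1) (u := v₂) (v := v₁)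
    (by simpa using (integrable_mul_L2 v₂ v₂).integrableOn)
    (by simpa using (integrable_mul_L2 v₂ v₁).integrableOn)
    (by simpa using (integrable_mul_L2 v₁ v₁).integrableOn) t
  simp only [one_mul] at hsq
  rw [hsq] at hpz
  have hQ' : 0 ≤ m₂ * (∫ x in Ω, v₂ x * v₂ x) + 2 * t * (m₂ * ∫ x in Ω, v₂ x * v₁ x)
      + t ^ 2 * (m₁ * ∫ x in Ω, v₁ x * v₁ x) := by
    rw [← e₁₁, ← e₂₂, ← e₂₁]
    linarith
  -- For equal eigenvalues the form equals m₁ ∫ (v₂ + t v₁)² < 0; for distinct ones the cross term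
  -- vanishes and both squares contribute with a negative eigenvalue.
  by_cases hm : m₁ = m₂
  · subst hm
    nlinarith
  · have h0 : ∫ x in Ω, v₂ x * v₁ x = 0 := by
      by_contra h
      exact hm (mul_right_cancel₀ h e₁₂)
    rw [h0] at hQ'
    nlinarith [mul_pos (neg_pos.mpr hm₂) hp₂,
      mul_nonneg (sq_nonneg t) (mul_pos (neg_pos.mpr hm₁) hp₁).le]

lemma eigenvalueCount_mono (Ω : Set (EuclideanSpace ℝ (Fin N))) (s lam p : ℝ) (u : L2 N)
    {S T : Set ℝ} (h : S ⊆ T) :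
    eigenvalueCount Ω s lam p u S ≤ eigenvalueCount Ω s lam p u T :=
  Submodule.rank_mono (Submodule.span_mono fun _ ⟨m, hm, hv⟩ => ⟨m, h hm, hv⟩)

lemma IsLeastEnergySolution.morseIndex_le_one {Ω : Set (EuclideanSpace ℝ (Fin N))}
    (hΩ : MeasurableSet Ω) (hΩb : Bornology.IsBounded Ω) {s lam p : ℝ} (hp : 1 < p) {u : L2 N}
    (hu : IsLeastEnergySolution Ω s lam p u) : morseIndex Ω s lam p u ≤ 1 := by
  by_cases hne : ∃ v₁ : L2 N, ∃ m ∈ Set.Iio (0 : ℝ), IsLinearizedEigenfunction Ω s lam p u m v₁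
  · obtain ⟨v₁, m₁, hm₁, h₁⟩ := hne
    refine (Submodule.rank_mono (Submodule.span_le.mpr ?_)).trans
      ((rank_span_le {v₁}).trans_eq (Cardinal.mk_singleton v₁))
    rintro v ⟨m, hm, hv⟩
    exact hu.mem_span_singleton hΩ hΩb hp hm₁ hm h₁ hv
  · refine (Submodule.rank_mono (Submodule.span_le (p := ⊥).mpr ?_)).trans ?_
    · rintro v ⟨m, hm, hv⟩
      exact absurd ⟨v, m, hm, hv⟩ hne
    · simp

end FracLaplace

open FracLaplace in
theorem proposition3p2 {N : ℕ} (Ω : Set (EuclideanSpace ℝ (Fin N))) (hΩ : IsOpen Ω)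
    (hΩb : Bornology.IsBounded Ω) (s p lam lam1 : ℝ) (hs0 : 0 < s) (hs1 : s < 1)
    (hp1 : 1 < p) (hp2 : p < ((N : ℝ) + 2 * s) / ((N : ℝ) - 2 * s))
    (hlam1 : IsFirstEigenvalue Ω s lam1) (hlam : lam < lam1)
    (u : L2 N) (hu : IsLeastEnergySolution Ω s lam p u) :
    (∀ μ₂ : ℝ, IsNthLinearizedEigenvalue Ω s lam p u 2 μ₂ → 0 ≤ μ₂) ∧
      morseIndex Ω s lam p u ≤ 1 := by
  have hM := hu.morseIndex_le_one hΩ.measurableSet hΩb hp1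
  refine ⟨fun μ₂ hμ₂ => ?_, hM⟩
  -- If μ₂ < 0, the two eigenvalues counted up to μ₂ are both negative, so the Morse index is at
  -- least 2.
  by_contra! hneg
  have h₂ : ((2 : ℕ) : Cardinal) ≤ eigenvalueCount Ω s lam p u (Set.Iic μ₂) := hμ₂.1
  have h := (h₂.trans (eigenvalueCount_mono Ω s lam p u (Set.Iic_subset_Iio.mpr hneg))).trans hM
  exact absurd h (by norm_num)
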